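/- Consider a rating system with a finite set $S$ of sellers and a finite set of $N$ buyers. For each seller $i$ let $B_i$ be the set of buyers who have already interacted with $i$, where $\sum_{i\in S}|B_i|\le N$; some of the buyers in $B_i$ have rated $i$ with a value in $[0,1]$, and $\bar r_i$ denotes the average of these ratings ($\bar r_i=0$ if there are none). Let $k\ge 0$ be the profit from one purchase and $\mathcal N=N-\sum_{i}|B_i|$ the number of potential buyers. In the bribery game $G$ every seller $i$ chooses a number $\phi_i\in\{0,1,\dots,\mathcal N\}$ of new buyers to bribe, at cost $1$ each, who then give rating $1$ and are no longer potential buyers. The payoff of seller $i$ is $$\pi_i(\phi)=u_i(\phi)-u_i^0-\phi_i,\qquad u_i(\phi)=k\Bigl(\mathcal N-\sum_{j\in S}\phi_j\Bigr)\frac{\bar r_i|B_i|+\phi_i}{|B_i|+\phi_i},\qquad u_i^0=k\,\mathcal N\,\bar r_i ,$$ where the quotient is read as $0$ if $|B_i|=\phi_i=0$. A (pure-strategy) Nash equilibrium is a profile $\phi=(\phi_i)_{i\in S}$ in which no seller can increase its payoff by changing its own strategy alone. Consider the constraints $$\phi_i\in\mathbb N,\qquad \sum_{i\in S}\phi_i\le\mathcal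 N,\qquad \phi_i=0\ \text{ if }\ |B_i|\ge k\,\mathcal N. \tag{C}$$ Theorem. 1. The bribery game $G$ has at least one Nash equilibrium (in pure strategies). 2. A profile $\phi\in\mathbb N^S$ is a Nash equilibrium if and only if it satisfies (C) and, for every seller $i$, the first-order condition in integers $$u_i(\phi_i+1,\phi_{-i})-u_i(\phi_i,\phi_{-i})\le 1,\qquad\text{and, if }\phi_i>0,\quad 1\le u_i(\phi_i,\phi_{-i})-u_i(\phi_i-1,\phi_{-i}).$$ 3. If $\phi$ is a Nash equilibrium and $B_i\ne\emptyset$, then up to rounding $\phi_i$ solves $\partial u_i/\partial\phi_i=1$ or is at the corner: either there is a real $x\ge 0$ with $|x-\phi_i|<1$ and $\frac{\partial u_i}{\partial\phi_i}(x,\phi_{-i})=1$, or $\phi_i=0$ and $\frac{\partial u_i}{\partial\phi_i}(0,\phi_{-i})\le 1$. 4. Conversely, if $\phi\in\mathbb N^S$ satisfies (C) and $\frac{\partial u_i}{\partial\phi_i}(\phi_i,\phi_{-i})=1$ for every seller $i$ with $|B_i|<k\,\mathcal N$, then $\phi$ is a Nash equilibrium. -/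

import Mathlib

/-- The data of a rating system in a fixed time slot, with set of sellers `S` and set of buyers
`B`. Each seller `i` sells one app. -/
structure RatingSystem (S B : Type*) [Fintype S] [Fintype B] where
  /-- `interacted i` is the set `B_i` of buyers who have already interacted with seller `i`. -/
  interacted : S → Finset B
  /-- The members of `B_i` who have submitted a rating (not every buyer rates). -/
  raters : S → Finset B
  raters_subset : ∀ i, raters i ⊆ interacted i
  /-- `rating i b` is the rating of seller `i` by buyer `b`; it is used for `b ∈ raters i` only. -/
  rating : S → B → ℝ
  rating_mem : ∀ i, ∀ b ∈ raters i, rating i b ∈ Set.Icc (0 : ℝ) 1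
  /-- The number `N - ∑ i, |B_i|` of potential buyers is not negative. -/
  sum_card_le : ∑ i, (interacted i).card ≤ Fintype.card B
  /-- The profit `k` from one app purchase. -/
  profit : ℝ
  profit_nonneg : 0 ≤ profit

namespace RatingSystem

variable {S B : Type*} [Fintype S] [Fintype B] (G : RatingSystem S B)

/-- The number `𝒩 = N - ∑ i, |B_i|` of potential buyers (no truncation, by `sum_card_le`). -/
def potentialBuyers : ℕ :=
  Fintype.card B - ∑ i, (G.interacted i).card

/-- The aggregated rating `r̄_i`: the average of the ratings received by seller `i`. For a seller
without any rating this is `0`. -/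
noncomputable def avgRating (i : S) : ℝ :=
  (∑ b ∈ G.raters i, G.rating i b) / ((G.raters i).card : ℝ)

/-- The utility `n * r * k` of a seller with aggregated rating `r` when there are `n` potential
buyers in the market. -/
def expectedUtility (n r : ℝ) : ℝ :=
  n * r * G.profit

/-- The aggregated rating of seller `i` after `x` new buyers have been bribed to give rating `1`:
`(r̄_i * |B_i| + x) / (|B_i| + x)`. For `|B_i| = 0` and `x = 0` this is `0`. -/
noncomputable def bribedRating (i : S) (x : ℝ) : ℝ :=
  (G.avgRating i * ((G.interacted i).card : ℝ) + x) / (((G.interacted i).card : ℝ) + x)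

/-- The initial utility `u⁰` of seller `i`. -/
noncomputable def initialUtility (i : S) : ℝ :=
  G.expectedUtility (G.potentialBuyers : ℝ) (G.avgRating i)

/-- The utility of seller `i` after every seller `j` has bribed `φ j` new buyers, who then no
longer are potential buyers. It is a function of real variables, so that it has partial
derivatives; strategies are natural numbers. -/
noncomputable def utility (i : S) (φ : S → ℝ) : ℝ :=
  G.expectedUtility ((G.potentialBuyers : ℝ) - ∑ j, φ j) (G.bribedRating i (φ i))

/-- The payoff of seller `i`: the gain in utility minus the cost of bribing `φ i` buyers. -/
noncomputable def payoff (i : S) (φ : S → ℝ) : ℝ :=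
  G.utility i φ - G.initialUtility i - φ i

/-- The finite strategy space of every seller: the number of buyers to bribe, out of the `𝒩`
potential buyers. -/
def strategySpace : Finset ℕ :=
  Finset.range (G.potentialBuyers + 1)

/-- A strategy profile in natural numbers, seen as a real vector. -/
def toReal (φ : S → ℕ) : S → ℝ :=
  fun j => (φ j : ℝ)

/-- `φ` is a (pure-strategy) Nash equilibrium of the bribery game: a profile of strategies such
that no seller gains by a unilateral change to another strategy. -/
def IsNashEquilibrium [DecidableEq S] (φ : S → ℕ) : Prop :=
  (∀ i, φ i ∈ G.strategySpace) ∧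
    ∀ i, ∀ x ∈ G.strategySpace,
      G.payoff i (Function.update (toReal φ) i (x : ℝ)) ≤ G.payoff i (toReal φ)

/-- Seller `i` has `|B_i| / 𝒩 ≥ k`. The quotient is multiplied out, so that this also makes sense
(and holds) if `𝒩 = 0`. -/
def IsSaturated (i : S) : Prop :=
  G.profit * (G.potentialBuyers : ℝ) ≤ ((G.interacted i).card : ℝ)

/-- The constraints on a profile of natural numbers: `∑ i, φ i ≤ 𝒩`, and `φ i = 0` if
`|B_i| / 𝒩 ≥ k`. -/
def SatisfiesConstraints (φ : S → ℕ) : Prop :=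
  ∑ i, φ i ≤ G.potentialBuyers ∧ ∀ i, G.IsSaturated i → φ i = 0

/-- The partial derivative `∂u_i / ∂φ_i` exists at the point where `φ_i = x` and all other
coordinates are those of `φ`, and it is equal to `d`. -/
def HasMarginalUtility [DecidableEq S] (i : S) (φ : S → ℕ) (x d : ℝ) : Prop :=
  HasDerivAt (fun y : ℝ => G.utility i (Function.update (toReal φ) i y)) d x

/-- The first-order condition `∂u_i / ∂φ_i = 1` in integers: the next bribed buyer adds at most
the cost `1` to the utility of seller `i`, and the last bribed buyer, if there is one, has added
at least `1`. -/
def IntegerFirstOrderCondition [DecidableEq S] (i : S) (φ : S → ℕ) : Prop :=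
  G.utility i (Function.update (toReal φ) i ((φ i : ℝ) + 1)) - G.utility i (toReal φ) ≤ 1 ∧
    (0 < φ i →
      1 ≤ G.utility i (toReal φ) - G.utility i (Function.update (toReal φ) i ((φ i : ℝ) - 1)))

end RatingSystem

/-!
Let seller `i` bribe `y` buyers while the others leave `A` potential buyers to it. Its rating
`ρ(y)` satisfies `(|B_i| + y) ρ(y) = r̄_i |B_i| + y`, so its utility minus its cost is
`k (A + |B_i|) ρ(y)` minus an affine function of `y`. As `ρ` is concave, so is this function on
`[0, ∞)` if `A ≥ 0`: the integer condition at the two neighbours of `φ_i`, or a vanishing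
derivative, gives a global maximum. Conversely, if an integer does at least as well as its two
neighbours, then there is a local maximum strictly between these, where the derivative vanishes.

For existence, the increment from `n` to `n + 1` bribes depends on the other sellers through `A`
only and is monotone in `A`, so the next bribe pays exactly if `A` passes a threshold `t_i(n)`.
Since `A = 𝒩 - ∑ j, φ j + φ i`, this compares `t_i(φ_i) - φ_i` with `𝒩 - ∑ j, φ j`, which does not
depend on `i`. These differences are the increments of a potential, and its minimizers subject to
`∑ j, φ j ≤ 𝒩` satisfy the integer conditions.
-/

open Set

section ThresholdPotential

variable {ι α : Type*} [Fintype ι] [AddCommGroup α]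

/-- A potential of the game in which every player `i` collects units of a common resource: the unit
number `n + 1` of player `i` has price `t i n`, and the unit number `m + 1` collected by all players
together has value `c m` to its owner. -/
def thresholdPotential (t : ι → ℕ → α) (c : ℕ → α) (φ : ι → ℕ) : α :=
  ∑ i, ∑ n ∈ Finset.range (φ i), t i n - ∑ m ∈ Finset.range (∑ i, φ i), c m

theorem thresholdPotential_add_single [DecidableEq ι] (t : ι → ℕ → α) (c : ℕ → α) (φ : ι → ℕ)
    (i : ι) :
    thresholdPotential t c (φ + Pi.single i 1) =
      thresholdPotential t c φ + (t i (φ i) - c (∑ j, φ j)) := by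
  have hprice (j : ι) : ∑ n ∈ Finset.range (φ j + Pi.single (M := fun _ => ℕ) i 1 j), t j n =
      ∑ n ∈ Finset.range (φ j), t j n + if j = i then t i (φ i) else 0 := by
    rcases eq_or_ne j i with rfl | hj
    · simp [Finset.sum_range_succ]
    · simp [hj]
  simp only [thresholdPotential, Pi.add_apply, hprice, Finset.sum_add_distrib,
    Fintype.sum_pi_single', Finset.sum_range_succ, Finset.sum_ite_eq', Finset.mem_univ, if_true]
  abel

theorem exists_threshold_equilibrium [LinearOrder α] [IsOrderedAddMonoid α]
    (t : ι → ℕ → α) (c : ℕ → α) (N : ℕ) :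
    ∃ φ : ι → ℕ, ∑ i, φ i ≤ N ∧ ∀ i,
      (∑ j, φ j < N → c (∑ j, φ j) ≤ t i (φ i)) ∧
      (0 < φ i → t i (φ i - 1) ≤ c (∑ j, φ j - 1)) := by
  classical
  have hfin : {φ : ι → ℕ | ∑ i, φ i ≤ N}.Finite :=
    (finite_Iic fun _ => N).subset fun φ hφ i =>
      (Finset.single_le_sum (fun _ _ => Nat.zero_le _) (Finset.mem_univ i)).trans hφ
  obtain ⟨φ, hφ, hmin⟩ := exists_min_image _ (thresholdPotential t c) hfin ⟨0, by simp⟩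
  have hsum (ψ : ι → ℕ) (i : ι) : ∑ j, (ψ + Pi.single i 1 : ι → ℕ) j = ∑ j, ψ j + 1 := by
    simp [Finset.sum_add_distrib]
  refine ⟨φ, hφ, fun i => ⟨fun hlt => ?_, fun hpos => ?_⟩⟩
  · have hle := hmin (φ + Pi.single i 1) ((hsum φ i).trans_le hlt)
    rwa [thresholdPotential_add_single, le_add_iff_nonneg_right, sub_nonneg] at hle
  · obtain ⟨ψ, rfl⟩ : ∃ ψ, φ = ψ + Pi.single i 1 :=
      ⟨φ - Pi.single i 1, (tsub_add_cancel_of_le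
        (update_le_iff.2 ⟨hpos, fun _ _ => Nat.zero_le _⟩)).symm⟩
    rw [mem_ofPred_eq, hsum] at hφ
    have hle := hmin ψ (Nat.le_of_succ_le hφ)
    rw [thresholdPotential_add_single, add_le_iff_nonpos_right, sub_nonpos] at hle
    rw [hsum]
    simpa using hle

end ThresholdPotential

section LocalMaxima

variable {X Y : Type*} [ConditionallyCompleteLinearOrder X] [TopologicalSpace X] [OrderTopology X]
  [LinearOrder Y] [TopologicalSpace Y] [OrderClosedTopology Y] {f : X → Y} {a b m : X}

theorem exists_isLocalMax_Ioo_of_endpoints_le (hf : ContinuousOn f (Icc a b)) (hm : m ∈ Ioo a b)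
    (ha : f a ≤ f m) (hb : f b ≤ f m) : ∃ x ∈ Ioo a b, IsLocalMax f x := by
  have hm' : m ∈ Icc a b := Ioo_subset_Icc_self hm
  obtain ⟨x, hx, hmax⟩ := isCompact_Icc.exists_isMaxOn ⟨m, hm'⟩ hf
  by_cases hx' : x ∈ Ioo a b
  · exact ⟨x, hx', hmax.isLocalMax (Icc_mem_nhds hx'.1 hx'.2)⟩
  · have hxm : f x ≤ f m := by
      rcases eq_endpoints_or_mem_Ioo_of_mem_Icc hx with rfl | rfl | h
      exacts [ha, hb, absurd h hx']
    exact ⟨m, hm, IsMaxOn.isLocalMax (fun y hy => (hmax hy).trans hxm)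
      (Icc_mem_nhds hm.1 hm.2)⟩

theorem isMaxOn_left_or_exists_isLocalMax_Ioo (hf : ContinuousOn f (Icc a b)) (hab : f b ≤ f a) :
    IsMaxOn f (Icc a b) a ∨ ∃ x ∈ Ioo a b, IsLocalMax f x := by
  refine or_iff_not_imp_left.2 fun hmax => ?_
  obtain ⟨m, hm, ham⟩ : ∃ m ∈ Icc a b, f a < f m := by
    simpa only [isMaxOn_iff, not_forall, not_le, exists_prop] using hmax
  have hma : m ≠ a := by rintro rfl; exact ham.false
  have hmb : m ≠ b := by rintro rfl; exact ham.not_ge hab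
  exact exists_isLocalMax_Ioo_of_endpoints_le hf ⟨hm.1.lt_of_ne' hma, hm.2.lt_of_ne hmb⟩ ham.le
    (hab.trans ham.le)

end LocalMaxima

theorem hasDerivAt_nonpos_of_isMaxOn_Icc_left {f : ℝ → ℝ} {a b d : ℝ} (hab : a < b)
    (hmax : IsMaxOn f (Icc a b) a) (hf : HasDerivAt f d a) : d ≤ 0 := by
  have hcone : (1 : ℝ) ∈ posTangentConeAt (Icc a b) a := by
    refine mem_posTangentConeAt_of_frequently_mem (Filter.Eventually.frequently ?_)
    filter_upwards [Ioo_mem_nhdsGT (sub_pos.2 hab)] with t ht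
    rw [smul_eq_mul, mul_one]
    constructor <;> linarith [ht.1, ht.2]
  simpa using hmax.localize.hasFDerivWithinAt_nonpos hf.hasFDerivAt.hasFDerivWithinAt hcone

theorem isMaxOn_of_concaveOn_of_hasDerivWithinAt_zero {f : ℝ → ℝ} {s : Set ℝ} {x : ℝ}
    (hf : ConcaveOn ℝ s f) (hx : x ∈ s) (hf' : HasDerivWithinAt f 0 s x) : IsMaxOn f s x := by
  refine isMaxOn_iff.2 fun y hy => ?_
  rcases lt_trichotomy x y with hxy | rfl | hyx
  · have := hf.slope_le_of_hasDerivWithinAt hx hy hxy hf'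
    rw [slope_def_field, div_le_iff₀ (sub_pos.2 hxy), zero_mul] at this
    exact sub_nonpos.1 this
  · exact le_rfl
  · have := hf.le_slope_of_hasDerivWithinAt hy hx hyx hf'
    rw [slope_def_field, le_div_iff₀ (sub_pos.2 hyx), zero_mul] at this
    exact sub_nonneg.1 this

theorem natCast_le_of_concaveOn_of_neighbors_le {f : ℝ → ℝ} (hf : ConcaveOn ℝ (Ici 0) f) {m : ℕ}
    (hsucc : f (m + 1) ≤ f m) (hpred : 0 < m → f (m - 1) ≤ f m) (n : ℕ) : f n ≤ f m := by
  rcases lt_trichotomy n m with hnm | rfl | hmn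
  · have hnm' : (n : ℝ) ≤ m - 1 := by
      rw [le_sub_iff_add_le]
      exact_mod_cast hnm
    have hm := hpred (Nat.zero_lt_of_lt hnm)
    exact (hf.left_le_of_le_right'' (mem_Ici.2 n.cast_nonneg) (mem_Ici.2 m.cast_nonneg) hnm'
      (sub_one_lt _) hm).trans hm
  · exact le_rfl
  · have hmn' : (m : ℝ) + 1 ≤ n := by exact_mod_cast hmn
    exact (hf.right_le_of_le_left'' (mem_Ici.2 m.cast_nonneg) (mem_Ici.2 n.cast_nonneg)
      (lt_add_one _) hmn' hsucc).trans hsucc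

namespace RatingSystem

variable {S B : Type*} [Fintype S] [Fintype B] (G : RatingSystem S B) (i : S)

section BribedRating

theorem avgRating_nonneg : 0 ≤ G.avgRating i :=
  div_nonneg (Finset.sum_nonneg fun b hb => (G.rating_mem i b hb).1) (Nat.cast_nonneg _)

theorem avgRating_le_one : G.avgRating i ≤ 1 := by
  refine div_le_one_of_le₀ ?_ (Nat.cast_nonneg _)
  simpa using Finset.sum_le_card_nsmul _ _ 1 fun b hb => (G.rating_mem i b hb).2

variable {y : ℝ}

theorem bribedRating_nonneg (hy : 0 ≤ y) : 0 ≤ G.bribedRating i y := by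
  have := G.avgRating_nonneg i
  unfold bribedRating
  positivity

theorem card_add_mul_bribedRating (hy : 0 ≤ y) :
    ((G.interacted i).card + y) * G.bribedRating i y =
      G.avgRating i * (G.interacted i).card + y := by
  rcases (add_nonneg (Nat.cast_nonneg (G.interacted i).card) hy).eq_or_lt with h | h
  · obtain ⟨hb, rfl⟩ := (add_eq_zero_iff_of_nonneg (Nat.cast_nonneg _) hy).1 h.symm
    simp [hb]
  · exact mul_div_cancel₀ _ h.ne'

theorem monotoneOn_bribedRating : MonotoneOn (G.bribedRating i) (Ici 0) := by
  intro x (hx : 0 ≤ x) y (hy : 0 ≤ y) hxy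
  have hb : (0 : ℝ) ≤ (G.interacted i).card := Nat.cast_nonneg _
  rcases (add_nonneg hb hx).eq_or_lt with h | h
  · rw [bribedRating, ← h, div_zero]
    exact G.bribedRating_nonneg i hy
  · rw [bribedRating, bribedRating, div_le_div_iff₀ h (by linarith)]
    have := mul_nonneg (mul_nonneg hb (sub_nonneg.2 (G.avgRating_le_one i))) (sub_nonneg.2 hxy)
    linarith

theorem bribedRating_le_add_one (hy : 0 ≤ y) : G.bribedRating i y ≤ G.bribedRating i (y + 1) :=
  G.monotoneOn_bribedRating i (mem_Ici.2 hy) (mem_Ici.2 (by linarith)) (by linarith)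

theorem concaveOn_bribedRating : ConcaveOn ℝ (Ici 0) (G.bribedRating i) := by
  refine ⟨convex_Ici 0, fun x hx y hy s t hs ht hst => ?_⟩
  have hz : 0 ≤ s * x + t * y := convex_Ici 0 hx hy hs ht hst
  have hmono : 0 ≤ (x - y) * (G.bribedRating i x - G.bribedRating i y) := by
    rcases le_total x y with h | h
    · exact mul_nonneg_of_nonpos_of_nonpos (sub_nonpos.2 h)
        (sub_nonpos.2 (G.monotoneOn_bribedRating i hx hy h))
    · exact mul_nonneg (sub_nonneg.2 h) (sub_nonneg.2 (G.monotoneOn_bribedRating i hy hx h))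
  simp only [smul_eq_mul]
  rcases (add_nonneg (Nat.cast_nonneg (G.interacted i).card) hz).eq_or_lt with h | h
  · obtain ⟨hb, hz₀⟩ := (add_eq_zero_iff_of_nonneg (Nat.cast_nonneg _) hz).1 h.symm
    obtain ⟨hx₀, hy₀⟩ := (add_eq_zero_iff_of_nonneg (mul_nonneg hs hx) (mul_nonneg ht hy)).1 hz₀
    have hzero : G.bribedRating i 0 = 0 := by simp [bribedRating, hb]
    rcases mul_eq_zero.1 hx₀ with rfl | rfl <;> rcases mul_eq_zero.1 hy₀ with rfl | rfl <;>
      simp [hzero]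
  · refine le_of_mul_le_mul_left ?_ h
    have := mul_nonneg (mul_nonneg hs ht) hmono
    linear_combination this + s * G.card_add_mul_bribedRating i hx +
      t * G.card_add_mul_bribedRating i hy - G.card_add_mul_bribedRating i hz +
      (G.avgRating i * (G.interacted i).card + s * x * G.bribedRating i x +
        t * y * G.bribedRating i y) * hst

end BribedRating

section NetUtility

/-- The utility of seller `i` minus its cost of bribing, as a function of the number `y` of buyers
it bribes, when the other sellers leave `A` potential buyers to it. -/
noncomputable def netUtility (A y : ℝ) : ℝ :=
  G.expectedUtility (A - y) (G.bribedRating i y) - y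

variable {A y : ℝ}

theorem netUtility_eq (hy : 0 ≤ y) :
    G.netUtility i A y = G.profit * (A + (G.interacted i).card) * G.bribedRating i y -
      ((G.profit + 1) * y + G.profit * (G.avgRating i * (G.interacted i).card)) := by
  rw [netUtility, expectedUtility]
  linear_combination -G.profit * G.card_add_mul_bribedRating i hy

theorem concaveOn_netUtility (hA : 0 ≤ A + (G.interacted i).card) :
    ConcaveOn ℝ (Ici 0) (G.netUtility i A) := by
  have hgain := (G.concaveOn_bribedRating i).smul (mul_nonneg G.profit_nonneg hA)
  have hloss := ((convexOn_id (convex_Ici (0 : ℝ))).smul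
    (add_nonneg G.profit_nonneg zero_le_one)).add_const
      (G.profit * (G.avgRating i * (G.interacted i).card))
  exact (hgain.sub hloss).congr fun y hy => (G.netUtility_eq i hy).symm

theorem netUtility_add_one_sub (hy : 0 ≤ y) :
    G.netUtility i A (y + 1) - G.netUtility i A y =
      G.profit * (A + (G.interacted i).card) *
        (G.bribedRating i (y + 1) - G.bribedRating i y) - (G.profit + 1) := by
  rw [G.netUtility_eq i hy, G.netUtility_eq i (by linarith)]
  ring

theorem netUtility_add_one_lt_of_le (hy : 0 ≤ y) (hA : A ≤ y) :
    G.netUtility i A (y + 1) < G.netUtility i A y := by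
  have hmono := sub_nonneg.2 (G.bribedRating_le_add_one i hy)
  have hgain : (A + (G.interacted i).card) * (G.bribedRating i (y + 1) - G.bribedRating i y) ≤ 1 :=
    calc _ ≤ (y + (G.interacted i).card) * (G.bribedRating i (y + 1) - G.bribedRating i y) := by
          gcongr
      _ = 1 - G.bribedRating i (y + 1) := by
          linear_combination G.card_add_mul_bribedRating i (add_nonneg hy zero_le_one) -
            G.card_add_mul_bribedRating i hy
      _ ≤ 1 := sub_le_self _ (G.bribedRating_nonneg i (add_nonneg hy zero_le_one))
  rw [← sub_neg, G.netUtility_add_one_sub i hy]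
  linarith [mul_le_mul_of_nonneg_left hgain G.profit_nonneg]

theorem exists_threshold_netUtility_add_one (N : ℝ) (hy : 0 ≤ y) : ∃ t : ℝ, ∀ A ≤ N,
    (A ≤ t → G.netUtility i A (y + 1) ≤ G.netUtility i A y) ∧
      (t ≤ A → G.netUtility i A y ≤ G.netUtility i A (y + 1)) := by
  have hk := G.profit_nonneg
  set δ := G.profit * (G.bribedRating i (y + 1) - G.bribedRating i y) with hδ
  have hincr (A : ℝ) : G.netUtility i A (y + 1) - G.netUtility i A y =
      δ * (A + (G.interacted i).card) - (G.profit + 1) := by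
    rw [G.netUtility_add_one_sub i hy, hδ]
    ring
  have hδ₀ : 0 ≤ δ := mul_nonneg hk (sub_nonneg.2 (G.bribedRating_le_add_one i hy))
  simp only [← sub_nonneg (b := G.netUtility i _ y), ← sub_nonpos (b := G.netUtility i _ y), hincr]
  rcases hδ₀.eq_or_lt with h | h
  · exact ⟨N + 1, fun A hA => ⟨fun _ => by rw [← h]; linarith, fun hA' => by linarith⟩⟩
  · refine ⟨(G.profit + 1) / δ - (G.interacted i).card, fun A _ => ?_⟩
    rw [le_sub_iff_add_le, le_div_iff₀' h, sub_nonpos, sub_le_iff_le_add, div_le_iff₀' h,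
      sub_nonneg]
    exact ⟨id, id⟩

theorem differentiableAt_netUtility (hy : (G.interacted i).card + y ≠ 0) :
    DifferentiableAt ℝ (G.netUtility i A) y := by
  unfold netUtility expectedUtility bribedRating
  fun_prop (disch := assumption)

variable {G i}

theorem IsSaturated.netUtility_add_one_lt (h : G.IsSaturated i)
    (hA : A ≤ G.potentialBuyers) (hy : 0 ≤ y) :
    G.netUtility i A (y + 1) < G.netUtility i A y := by
  have hk := G.profit_nonneg
  have hmono := sub_nonneg.2 (G.bribedRating_le_add_one i hy)
  have hcost : G.profit * (A + (G.interacted i).card) ≤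
      (G.profit + 1) * (G.interacted i).card := by
    have := (mul_le_mul_of_nonneg_left hA hk).trans h
    linarith
  have hgain : ((G.interacted i).card + y + 1) *
      (G.bribedRating i (y + 1) - G.bribedRating i y) ≤ 1 := by
    linarith [G.card_add_mul_bribedRating i hy, G.bribedRating_nonneg i hy,
      G.card_add_mul_bribedRating i (add_nonneg hy zero_le_one)]
  have hlt : (G.interacted i).card * (G.bribedRating i (y + 1) - G.bribedRating i y) < 1 := by
    rcases hmono.eq_or_lt with h₀ | hpos
    · rw [← h₀, mul_zero]
      exact zero_lt_one
    · exact (mul_lt_mul_of_pos_right (by linarith) hpos).trans_le hgain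
  rw [← sub_neg, G.netUtility_add_one_sub i hy, sub_neg]
  calc _ ≤ (G.profit + 1) * (G.interacted i).card *
          (G.bribedRating i (y + 1) - G.bribedRating i y) := by gcongr
    _ = (G.profit + 1) *
          ((G.interacted i).card * (G.bribedRating i (y + 1) - G.bribedRating i y)) :=
        mul_assoc _ _ _
    _ < G.profit + 1 := mul_lt_of_lt_one_right (by positivity) hlt

theorem IsSaturated.antitone_netUtility (h : G.IsSaturated i)
    (hA : A ≤ G.potentialBuyers) : Antitone fun n : ℕ => G.netUtility i A n :=
  antitone_nat_of_succ_le fun n => by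
    simpa using (h.netUtility_add_one_lt hA n.cast_nonneg).le

end NetUtility

section AvailableBuyers

/-- The number of potential buyers that the sellers other than `i` leave to seller `i`. It is
negative if they bribe more buyers than there are. -/
def availableBuyers (φ : S → ℕ) : ℝ :=
  G.potentialBuyers - ∑ j, (φ j : ℝ) + φ i

variable (φ : S → ℕ)

theorem availableBuyers_le_potentialBuyers : G.availableBuyers i φ ≤ G.potentialBuyers := by
  have := Finset.single_le_sum (f := fun j => (φ j : ℝ)) (fun j _ => Nat.cast_nonneg _)
    (Finset.mem_univ i)
  rw [availableBuyers]
  linarith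

theorem utility_toReal : G.utility i (toReal φ) =
    G.netUtility i (G.availableBuyers i φ) (φ i) + φ i := by
  simp only [netUtility, availableBuyers, add_sub_cancel_right, sub_add_cancel]
  rfl

variable {φ}

theorem availableBuyers_nonneg (h : ∑ j, φ j ≤ G.potentialBuyers) :
    0 ≤ G.availableBuyers i φ := by
  have : ∑ j, (φ j : ℝ) ≤ G.potentialBuyers := by exact_mod_cast h
  rw [availableBuyers]
  linarith [(φ i).cast_nonneg (α := ℝ)]

theorem availableBuyers_le_sub_one (h : G.potentialBuyers < ∑ j, φ j) :
    G.availableBuyers i φ ≤ φ i - 1 := by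
  have : (G.potentialBuyers : ℝ) + 1 ≤ ∑ j, (φ j : ℝ) := by exact_mod_cast h
  rw [availableBuyers]
  linarith

theorem concaveOn_netUtility_of_sum_le (hsum : ∑ j, φ j ≤ G.potentialBuyers) :
    ConcaveOn ℝ (Ici 0) (G.netUtility i (G.availableBuyers i φ)) :=
  G.concaveOn_netUtility i (add_nonneg (G.availableBuyers_nonneg i hsum) (Nat.cast_nonneg _))

end AvailableBuyers

section Equilibrium

variable [DecidableEq S] (φ : S → ℕ)

theorem utility_update (y : ℝ) : G.utility i (Function.update (toReal φ) i y) =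
    G.netUtility i (G.availableBuyers i φ) y + y := by
  have hsum : ∑ j, Function.update (toReal φ) i y j = ∑ j, (φ j : ℝ) - φ i + y := by
    rw [Finset.sum_update_of_mem (Finset.mem_univ i), Finset.sdiff_singleton_eq_erase,
      Finset.sum_erase_eq_sub (Finset.mem_univ i)]
    exact add_comm _ _
  rw [utility, hsum, Function.update_self, netUtility, availableBuyers, sub_add_cancel]
  ring_nf

theorem hasMarginalUtility_iff_hasDerivAt_netUtility (x d : ℝ) : G.HasMarginalUtility i φ x d ↔
    HasDerivAt (G.netUtility i (G.availableBuyers i φ)) (d - 1) x := by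
  simp only [HasMarginalUtility, utility_update]
  refine ⟨fun h => ?_, fun h => ?_⟩
  · simpa only [add_sub_cancel_right] using h.fun_sub (hasDerivAt_id' x)
  · simpa only [sub_add_cancel] using h.fun_add (hasDerivAt_id' x)

theorem integerFirstOrderCondition_iff_netUtility_le : G.IntegerFirstOrderCondition i φ ↔
    G.netUtility i (G.availableBuyers i φ) (φ i + 1) ≤
      G.netUtility i (G.availableBuyers i φ) (φ i) ∧
    (0 < φ i → G.netUtility i (G.availableBuyers i φ) (φ i - 1) ≤
      G.netUtility i (G.availableBuyers i φ) (φ i)) := by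
  rw [IntegerFirstOrderCondition, utility_toReal, utility_update, utility_update]
  refine and_congr ?_ (imp_congr_right fun _ => ?_) <;> constructor <;> intro h <;> linarith

theorem isNashEquilibrium_iff_netUtility_le : G.IsNashEquilibrium φ ↔
    ∀ i, φ i ≤ G.potentialBuyers ∧ ∀ n ≤ G.potentialBuyers,
      G.netUtility i (G.availableBuyers i φ) n ≤ G.netUtility i (G.availableBuyers i φ) (φ i) := by
  have hpayoff (i : S) (n : ℕ) :
      G.payoff i (Function.update (toReal φ) i n) ≤ G.payoff i (toReal φ) ↔
        G.netUtility i (G.availableBuyers i φ) n ≤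
          G.netUtility i (G.availableBuyers i φ) (φ i) := by
    rw [payoff, payoff, utility_update, utility_toReal, Function.update_self, toReal]
    constructor <;> intro h <;> linarith
  simp only [IsNashEquilibrium, strategySpace, Finset.mem_range_succ_iff, hpayoff, forall_and]

variable {G i φ}

theorem isNashEquilibrium_of_sum_le (hsum : ∑ j, φ j ≤ G.potentialBuyers)
    (hmax : ∀ i, ∀ n : ℕ, G.netUtility i (G.availableBuyers i φ) n ≤
      G.netUtility i (G.availableBuyers i φ) (φ i)) : G.IsNashEquilibrium φ :=
  (G.isNashEquilibrium_iff_netUtility_le φ).2 fun i =>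
    ⟨(Finset.single_le_sum (fun _ _ => Nat.zero_le _) (Finset.mem_univ i)).trans hsum,
      fun n _ => hmax i n⟩

theorem isNashEquilibrium_of_integerFirstOrderCondition (hsum : ∑ j, φ j ≤ G.potentialBuyers)
    (hfoc : ∀ i, G.IntegerFirstOrderCondition i φ) : G.IsNashEquilibrium φ :=
  isNashEquilibrium_of_sum_le hsum fun i =>
    have ⟨hsucc, hpred⟩ := (G.integerFirstOrderCondition_iff_netUtility_le i φ).1 (hfoc i)
    natCast_le_of_concaveOn_of_neighbors_le (G.concaveOn_netUtility_of_sum_le i hsum)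
      hsucc hpred

theorem IsNashEquilibrium.integerFirstOrderCondition (h : G.IsNashEquilibrium φ) (i : S) :
    G.IntegerFirstOrderCondition i φ := by
  obtain ⟨hφ, hmax⟩ := (G.isNashEquilibrium_iff_netUtility_le φ).1 h i
  refine (G.integerFirstOrderCondition_iff_netUtility_le i φ).2 ⟨?_, fun hpos => ?_⟩
  · rcases hφ.eq_or_lt with heq | hlt
    · refine (G.netUtility_add_one_lt_of_le i (Nat.cast_nonneg _) ?_).le
      rw [heq]
      exact G.availableBuyers_le_potentialBuyers i φ
    · exact_mod_cast hmax (φ i + 1) hlt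
  · simpa only [Nat.cast_pred hpos] using hmax (φ i - 1) ((Nat.sub_le _ _).trans hφ)

theorem IntegerFirstOrderCondition.eq_zero_of_netUtility_lt
    (hfoc : G.IntegerFirstOrderCondition i φ)
    (hlt : ∀ y : ℝ, 0 ≤ y → (φ i : ℝ) = y + 1 →
      G.netUtility i (G.availableBuyers i φ) (y + 1) < G.netUtility i (G.availableBuyers i φ) y) :
    φ i = 0 := by
  by_contra hne
  have hpos := Nat.pos_of_ne_zero hne
  have hpred := ((G.integerFirstOrderCondition_iff_netUtility_le i φ).1 hfoc).2 hpos
  have hφ : (0 : ℝ) ≤ φ i - 1 := sub_nonneg.2 (Nat.one_le_cast.2 hpos)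
  have := hlt _ hφ (sub_add_cancel _ _).symm
  rw [sub_add_cancel] at this
  exact this.not_ge hpred

theorem IsNashEquilibrium.satisfiesConstraints (h : G.IsNashEquilibrium φ) :
    G.SatisfiesConstraints φ := by
  constructor
  · by_contra! hlt
    have hzero (i : S) : φ i = 0 :=
      (h.integerFirstOrderCondition i).eq_zero_of_netUtility_lt fun y hy hφ =>
        G.netUtility_add_one_lt_of_le i hy <| by
          linarith [G.availableBuyers_le_sub_one i hlt]
    simp [hzero] at hlt
  · exact fun i hi => (h.integerFirstOrderCondition i).eq_zero_of_netUtility_lt fun y hy _ =>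
      hi.netUtility_add_one_lt (G.availableBuyers_le_potentialBuyers i φ) hy

variable (G) in
theorem exists_isNashEquilibrium : ∃ φ : S → ℕ, G.IsNashEquilibrium φ := by
  choose t ht using fun (i : S) (n : ℕ) =>
    G.exists_threshold_netUtility_add_one i G.potentialBuyers n.cast_nonneg
  obtain ⟨φ, hsum, hφ⟩ := exists_threshold_equilibrium (fun i n => t i n - n)
    (fun m => (G.potentialBuyers : ℝ) - m) G.potentialBuyers
  refine ⟨φ, isNashEquilibrium_of_integerFirstOrderCondition hsum fun i =>
    (G.integerFirstOrderCondition_iff_netUtility_le i φ).2 ⟨?_, fun hpos => ?_⟩⟩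
  · rcases hsum.eq_or_lt with heq | hlt
    · refine (G.netUtility_add_one_lt_of_le i (Nat.cast_nonneg _) ?_).le
      rw [availableBuyers, ← heq]
      push_cast
      linarith
    · refine (ht i (φ i) _ (G.availableBuyers_le_potentialBuyers i φ)).1 ?_
      have := (hφ i).1 hlt
      push_cast at this
      rw [availableBuyers]
      linarith
  · have hcross := (ht i (φ i - 1) _ (G.availableBuyers_le_potentialBuyers i φ)).2
    rw [Nat.cast_pred hpos, sub_add_cancel] at hcross
    refine hcross ?_
    have hpos' : 0 < ∑ j, φ j :=
      hpos.trans_le (Finset.single_le_sum (fun _ _ => Nat.zero_le _) (Finset.mem_univ i))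
    have := (hφ i).2 hpos
    rw [Nat.cast_pred hpos, Nat.cast_pred hpos'] at this
    push_cast at this
    rw [availableBuyers]
    linarith

theorem isNashEquilibrium_iff_integerFirstOrderCondition : G.IsNashEquilibrium φ ↔
    G.SatisfiesConstraints φ ∧ ∀ i, G.IntegerFirstOrderCondition i φ :=
  ⟨fun h => ⟨h.satisfiesConstraints, h.integerFirstOrderCondition⟩,
    fun h => isNashEquilibrium_of_integerFirstOrderCondition h.1.1 h.2⟩

theorem IntegerFirstOrderCondition.exists_hasMarginalUtility
    (hfoc : G.IntegerFirstOrderCondition i φ) (hB : (G.interacted i).Nonempty) :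
    (∃ x : ℝ, 0 ≤ x ∧ |x - (φ i : ℝ)| < 1 ∧ G.HasMarginalUtility i φ x 1) ∨
      (φ i = 0 ∧ ∃ d : ℝ, d ≤ 1 ∧ G.HasMarginalUtility i φ 0 d) := by
  simp only [hasMarginalUtility_iff_hasDerivAt_netUtility, sub_self]
  obtain ⟨hsucc, hpred⟩ := (G.integerFirstOrderCondition_iff_netUtility_le i φ).1 hfoc
  set f := G.netUtility i (G.availableBuyers i φ)
  have hdiff {x : ℝ} (hx : 0 ≤ x) : DifferentiableAt ℝ f x := by
    have : (0 : ℝ) < (G.interacted i).card := Nat.cast_pos.2 hB.card_pos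
    exact G.differentiableAt_netUtility i (by positivity)
  have hcont {a b : ℝ} (ha : 0 ≤ a) : ContinuousOn f (Icc a b) := fun x hx =>
    (hdiff (ha.trans hx.1)).continuousAt.continuousWithinAt
  have hcrit {x : ℝ} (hx : 0 ≤ x) (hmax : IsLocalMax f x) : HasDerivAt f 0 x :=
    hmax.deriv_eq_zero ▸ (hdiff hx).hasDerivAt
  rcases (φ i).eq_zero_or_pos with hzero | hpos
  · rw [hzero, Nat.cast_zero, zero_add] at hsucc
    rcases isMaxOn_left_or_exists_isLocalMax_Ioo (hcont le_rfl) hsucc with hmax | ⟨x, hx, hmax⟩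
    · have hderiv := (hdiff le_rfl).hasDerivAt
      refine .inr ⟨hzero, deriv f 0 + 1, ?_, by simpa using hderiv⟩
      linarith [hasDerivAt_nonpos_of_isMaxOn_Icc_left zero_lt_one hmax hderiv]
    · refine .inl ⟨x, hx.1.le, ?_, hcrit hx.1.le hmax⟩
      rw [hzero, Nat.cast_zero, sub_zero, abs_of_pos hx.1]
      exact hx.2
  · have hone : (1 : ℝ) ≤ φ i := Nat.one_le_cast.2 hpos
    obtain ⟨x, hx, hmax⟩ := exists_isLocalMax_Ioo_of_endpoints_le
      (hcont (sub_nonneg.2 hone)) ⟨sub_one_lt _, lt_add_one _⟩ (hpred hpos) hsucc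
    have hx₀ : 0 ≤ x := (sub_nonneg.2 hone).trans hx.1.le
    exact .inl ⟨x, hx₀, abs_sub_lt_iff.2 ⟨by linarith [hx.2], by linarith [hx.1]⟩, hcrit hx₀ hmax⟩

theorem SatisfiesConstraints.isNashEquilibrium (hC : G.SatisfiesConstraints φ)
    (h : ∀ i, G.IsSaturated i ∨ G.HasMarginalUtility i φ (φ i) 1) : G.IsNashEquilibrium φ := by
  refine isNashEquilibrium_of_sum_le hC.1 fun i n => ?_
  rcases h i with hsat | hmarg
  · rw [hC.2 i hsat]
    exact hsat.antitone_netUtility (G.availableBuyers_le_potentialBuyers i φ) n.zero_le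
  · rw [hasMarginalUtility_iff_hasDerivAt_netUtility, sub_self] at hmarg
    exact isMaxOn_of_concaveOn_of_hasDerivWithinAt_zero
      (G.concaveOn_netUtility_of_sum_le i hC.1) (mem_Ici.2 (Nat.cast_nonneg _))
      hmarg.hasDerivWithinAt (mem_Ici.2 n.cast_nonneg)

end Equilibrium

end RatingSystem

theorem mainTheorem1 {S B : Type*} [Fintype S] [DecidableEq S] [Fintype B]
    (G : RatingSystem S B) :
    -- The bribery game has a Nash equilibrium.
    (∃ φ : S → ℕ, G.IsNashEquilibrium φ) ∧
    -- The equilibria are the solutions of the integer first-order conditions under the constraints.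
    (∀ φ : S → ℕ, G.IsNashEquilibrium φ ↔
      G.SatisfiesConstraints φ ∧ ∀ i, G.IntegerFirstOrderCondition i φ) ∧
    -- Up to rounding, an equilibrium solves `∂u_i / ∂φ_i = 1`, or is at the corner `φ_i = 0`.
    (∀ φ : S → ℕ, G.IsNashEquilibrium φ → ∀ i, (G.interacted i).Nonempty →
      (∃ x : ℝ, 0 ≤ x ∧ |x - (φ i : ℝ)| < 1 ∧ G.HasMarginalUtility i φ x 1) ∨
      (φ i = 0 ∧ ∃ d : ℝ, d ≤ 1 ∧ G.HasMarginalUtility i φ 0 d)) ∧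
    -- Exact solutions of `∂u_i / ∂φ_i = 1` under the constraints are equilibria.
    (∀ φ : S → ℕ, G.SatisfiesConstraints φ →
      (∀ i, G.IsSaturated i ∨ G.HasMarginalUtility i φ (φ i : ℝ) 1) →
      G.IsNashEquilibrium φ) := by
  exact ⟨G.exists_isNashEquilibrium,
    fun _ => RatingSystem.isNashEquilibrium_iff_integerFirstOrderCondition,
    fun _ hφ i hB => (hφ.integerFirstOrderCondition i).exists_hasMarginalUtility hB,
    fun _ hC hfoc => hC.isNashEquilibrium hfoc⟩
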